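/- For integers $n\ge 0$ and $0\le k,x\le n$ let $$\Bbbk_k^{(n)}(x)=\binom{n}{k}^{-1}\sum_{j=0}^k(-1)^j\binom{x}{j}\binom{n-x}{k-j}$$ be the normalized Krawtchouk polynomial. Call $c\in(0,1)$ a *Krawtchouk constant* if $|\Bbbk_k^{(n)}(x)|\le e^{-ckx/n}$ for all integers $n\ge 0$ and all integers $0\le k,x\le n/2$ (for $n=0$ the exponent is read as $0$). For integers $d,\lambda\ge 1$ put $t=\sqrt\lambda$, $\kappa(d,\lambda)=(\lambda/d)^{1/2}$, $S_t\cap\mathbb Z^d=\{x\in\mathbb Z^d: x_1^2+\dots+x_d^2=\lambda\}$ and, whenever $S_t\cap\mathbb Z^d\neq\emptyset$ (in particular for $d\ge5$), $$\mathfrak m_t(\xi)=\frac1{|S_t\cap\mathbb Z^d|}\sum_{x\in S_t\cap\mathbb Z^d}e^{2\pi i\,\xi\cdot x},\qquad \xi\in\mathbb T^d=\mathbb R^d/\mathbb Z^d .$$ **Proposition 7.3.** Krawtchouk constants exist, and there is an absolute constant $C>0$ such that for every Krawtchouk constant $c\in(0,1)$, all integers $d\ge5$ and $\lambda\ge1$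 with $\kappa(d,\lambda)\le 1/5$, and every $\xi\in\mathbb T^d$, $$|\mathfrak m_t(\xi)|\le C\Big(e^{-\frac{c\,\kappa(d,\lambda)^2}{100}\sum_{i=1}^d\sin^2(\pi\xi_i)}+e^{-\frac{c\,\kappa(d,\lambda)^2}{100}\sum_{i=1}^d\cos^2(\pi\xi_i)}\Big).$$ -/

import Mathlib

/-- The lattice points on the Euclidean sphere of radius `t = √lam` in `ℝ^d`, as a finite set:
`S_t ∩ ℤ^d = {x ∈ ℤ^d : x_1² + ⋯ + x_d² = lam}`.  The ambient box `[-lam, lam]^d` only serves to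
make finiteness visible; see `mem_latticeSphere`. -/
noncomputable def latticeSphere (d lam : ℕ) : Finset (Fin d → ℤ) :=
  (Fintype.piFinset fun _ : Fin d => Finset.Icc (-(lam : ℤ)) (lam : ℤ)).filter
    fun x => ∑ i, x i ^ 2 = (lam : ℤ)

theorem mem_latticeSphere {d lam : ℕ} {x : Fin d → ℤ} :
    x ∈ latticeSphere d lam ↔ ∑ i, x i ^ 2 = (lam : ℤ) := by
  unfold latticeSphere
  rw [Finset.mem_filter]
  refine ⟨fun h => h.2, fun h => ⟨?_, h⟩⟩
  rw [Fintype.mem_piFinset]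
  intro i
  have h1 : x i ^ 2 ≤ (lam : ℤ) := by
    rw [← h]
    exact Finset.single_le_sum (f := fun j => x j ^ 2) (fun j _ => sq_nonneg (x j))
      (Finset.mem_univ i)
  have h2 : |x i| ≤ x i ^ 2 := by
    rw [← sq_abs]
    exact Int.le_self_sq _
  rw [Finset.mem_Icc]
  exact abs_le.mp (h2.trans h1)

/-- The multiplier of the discrete spherical average of radius `t = √lam` on `ℤ^d`:
`𝔪_t(ξ) = |S_t ∩ ℤ^d|⁻¹ ∑_{x ∈ S_t ∩ ℤ^d} exp(2πi ξ·x)`, as a `ℤ^d`-periodic function of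
`ξ ∈ ℝ^d`, that is, as a function on the torus `ℝ^d / ℤ^d`. -/
noncomputable def sphericalMultiplier (d lam : ℕ) (ξ : Fin d → ℝ) : ℂ :=
  ((latticeSphere d lam).card : ℂ)⁻¹ *
    ∑ x ∈ latticeSphere d lam,
      Complex.exp (2 * (Real.pi : ℂ) * Complex.I * ((∑ i, ξ i * (x i : ℝ) : ℝ) : ℂ))

/-- The proportionality constant `κ(d, lam) = (lam / d)^{1/2}`. -/
noncomputable def proportionality (d lam : ℕ) : ℝ :=
  Real.sqrt ((lam : ℝ) / (d : ℝ))

/-- The `k`-th normalized Krawtchouk polynomial of order `n` at the integer `x`, for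
`0 ≤ x, k ≤ n`:
`binom(n,k)⁻¹ ∑_{j=0}^k (-1)^j binom(x,j) binom(n-x,k-j)`. -/
noncomputable def krawtchouk (n k x : ℕ) : ℝ :=
  ((n.choose k : ℕ) : ℝ)⁻¹ *
    ∑ j ∈ Finset.range (k + 1),
      (-1 : ℝ) ^ j * ((x.choose j : ℕ) : ℝ) * (((n - x).choose (k - j) : ℕ) : ℝ)

/-- `c ∈ (0, 1)` is a constant for which the uniform exponential bound
`|k_k^{(n)}(x)| ≤ exp(-c k x / n)` holds for all `n ∈ ℕ₀` and all integers `0 ≤ x, k ≤ n / 2`. -/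
def IsKrawtchoukConstant (c : ℝ) : Prop :=
  0 < c ∧ c < 1 ∧
    ∀ n k x : ℕ, 2 * k ≤ n → 2 * x ≤ n →
      |krawtchouk n k x| ≤ Real.exp (-(c * (k : ℝ) * (x : ℝ) / (n : ℝ)))

/-! Krawtchouk constants. For `2 * x ≤ n` the unnormalized Krawtchouk value is the `k`-th
coefficient of `(1 - X^2)^x * (1 + X)^(n - 2x)`. Each factor `1 - X^2` gives `a_k - a_{k-2}`. By the
triangle inequality this discards the proportion of `k`-subsets that split a fixed pair of points,
and induction on `x` yields exponential decay (`abs_coeff_one_sub_sq_pow_mul_le`).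

Multiplier. Fix the coordinates of absolute value at least 2 of a lattice point. The others lie in
`{-1, 0, 1}`, with a prescribed number `k` of units, so the exponential sum over such a fibre is a
coefficient of `∏ (1 + 2 cos(2πξ_i) X)`. Since `cos(2πξ_i) = 1 - 2 sin²(πξ_i)` is the mean of a
random sign, this coefficient is an average of Krawtchouk values over a random subset, and
independence turns their decay into the two exponentials, restricted to the free coordinates
(`norm_sum_sphereFiber_le`).

To restore the full sums over `i`, average over fibres: the family of points used is
permutation-invariant and has few big coordinates, so these rarely cover the important `i`
(`sum_exp_neg_compl_bigSupport_le`). Points with too few unit coordinates form an exponentially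
small proportion of the sphere, by a weighted count (`card_filter_bigPart_latticeSphere_le`), and
the smaller of `∑ sin²` and `∑ cos²` is at most `d/2`, so their contribution is absorbed. -/

/-! ### Existence of Krawtchouk constants -/

open Polynomial in
theorem coeff_one_sub_X_pow' (x j : ℕ) :
    ((1 - X : ℝ[X]) ^ x).coeff j = (-1) ^ j * (x.choose j : ℝ) := by
  have h : (1 - X : ℝ[X]) ^ x = ((1 + X : ℝ[X]) ^ x).comp (C (-1) * X) := by
    simp [sub_eq_add_neg]
  rw [h, comp_C_mul_X_coeff, coeff_one_add_X_pow, mul_comm]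

open Polynomial in
/-- The coefficients of `(1 - X) ^ x * (1 + X) ^ (n - x)` are the unnormalized Krawtchouk
polynomials. -/
theorem krawtchouk_eq_coeff (n k x : ℕ) :
    krawtchouk n k x =
      (n.choose k : ℝ)⁻¹ * ((1 - X : ℝ[X]) ^ x * (1 + X) ^ (n - x)).coeff k := by
  unfold krawtchouk
  rw [coeff_mul, Finset.Nat.sum_antidiagonal_eq_sum_range_succ_mk]
  simp only [coeff_one_sub_X_pow', coeff_one_add_X_pow]

/-- The quadratic upper bound for one exponential term of the recursion. -/
theorem mul_exp_le_quadratic {n k y v : ℝ} (hn : 4 ≤ n) (hk2 : k = 0 ∨ k = 1 ∨ 2 ≤ k)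
    (hkn : k ≤ n) (hy0 : 0 ≤ y) (hy : y ≤ 1 / 2) (hv : |v| ≤ 2 * (n - k) / (n - 3)) :
    k * (k - 1) * Real.exp (1 / 4 * (y * v)) ≤
      k * (k - 1) + k * (k - 1) * (1 / 4 * (y * v)) + 9 / 64 * (k * (n - k)) := by
  rcases hk2 with rfl | rfl | hk2
  · simp
  · simp; linarith
  have hn3 : 0 < n - 3 := by linarith
  -- This needs `2 ≤ k`; for `k = 0, 1` the prefactor `k * (k - 1)` vanishes instead.
  have hr : 2 * (n - k) / (n - 3) ≤ 4 := by
    rw [div_le_iff₀ hn3]; linarith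
  have hu : |1 / 4 * (y * v)| ≤ 1 / 4 * ((n - k) / (n - 3)) := by
    rw [abs_mul, abs_mul, abs_of_nonneg hy0, abs_of_pos (by norm_num : (0 : ℝ) < 1 / 4)]
    have : y * |v| ≤ 1 / 2 * (2 * (n - k) / (n - 3)) := by gcongr
    have e : 1 / 2 * (2 * (n - k) / (n - 3)) = (n - k) / (n - 3) := by ring
    rw [e] at this
    linarith
  set u := 1 / 4 * (y * v)
  have hu1 : |u| ≤ 1 := by
    have e : 2 * (n - k) / (n - 3) = 2 * ((n - k) / (n - 3)) := by ring
    linarith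
  have hexp : Real.exp u ≤ 1 + u + u ^ 2 := by
    have := (abs_le.mp (Real.abs_exp_sub_one_sub_id_le hu1)).2
    linarith
  have hsq : u ^ 2 ≤ (1 / 4 * ((n - k) / (n - 3))) ^ 2 := by
    rw [← sq_abs u]; gcongr
  have hq : (k - 1) * (1 / 4 * ((n - k) / (n - 3))) ^ 2 ≤ 9 / 64 * (n - k) := by
    have e : (k - 1) * (1 / 4 * ((n - k) / (n - 3))) ^ 2 =
        (n - k) * ((k - 1) * (n - k) / (16 * (n - 3) ^ 2)) := by
      field_simp; ring
    -- AM-GM gives `(k - 1)(n - k) ≤ (n - 1)²/4`, and `n - 1 ≤ 3(n - 3)` because `n ≥ 4`.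
    have h2 : (k - 1) * (n - k) / (16 * (n - 3) ^ 2) ≤ 9 / 64 := by
      rw [div_le_iff₀ (by positivity)]
      nlinarith [sq_nonneg (k - 1 - (n - k)), mul_nonneg (by linarith : 0 ≤ n - 4) hn3.le]
    rw [e]
    nlinarith
  have hkk : 0 ≤ k * (k - 1) := mul_nonneg (by linarith) (by linarith)
  calc k * (k - 1) * Real.exp u ≤ k * (k - 1) * (1 + u + u ^ 2) := by gcongr
    _ = k * (k - 1) + k * (k - 1) * u + k * ((k - 1) * u ^ 2) := by ring
    _ ≤ k * (k - 1) + k * (k - 1) * u + k * (9 / 64 * (n - k)) := by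
        have : (k - 1) * u ^ 2 ≤ 9 / 64 * (n - k) :=
          le_trans (mul_le_mul_of_nonneg_left hsq (by linarith)) hq
        have hk0 : 0 ≤ k := by linarith
        gcongr
    _ = _ := by ring

/-- Half the probability that a fixed pair of points is split by a random `k`-subset of an
`n`-set. -/
noncomputable def splitWeight (n k : ℝ) : ℝ := k * (n - k) / (n * (n - 1))

/-- The two prefactors sum to `n(n-1) - 2k(n-k)`, whereas the right side needs a loss of only
`k(n-k)/4`. The surplus pays for the change of weight from `n` to `n - 2`: at most `k(n-k)/6` to
first order and `2 · 9/64 · k(n-k)` to second. The disjunctions stand in for integrality of `k` and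
`n - k`. -/
theorem splitWeight_step {n k x : ℝ} (hn : 4 ≤ n) (hx0 : 0 ≤ x) (hx : 2 * x ≤ n - 2)
    (hk : k = 0 ∨ k = 1 ∨ 2 ≤ k) (hk' : n - k = 0 ∨ n - k = 1 ∨ 2 ≤ n - k) :
    k * (k - 1) * Real.exp (-(1 / 4 * x * splitWeight (n - 2) (k - 2))) +
      (n - k) * (n - k - 1) * Real.exp (-(1 / 4 * x * splitWeight (n - 2) k)) ≤
      n * (n - 1) * Real.exp (-(1 / 4 * (x + 1) * splitWeight n k)) := by
  have h0 : 0 < n := by linarith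
  have h1 : 0 < n - 1 := by linarith
  have h2 : 0 < n - 2 := by linarith
  have h3 : 0 < n - 3 := by linarith
  have hk0 : 0 ≤ k := by rcases hk with h | h | h <;> linarith
  have hkn : 0 ≤ n - k := by rcases hk' with h | h | h <;> linarith
  set g := splitWeight n k with hg
  set y := x / (n - 2) with hy
  have hy0 : 0 ≤ y := by positivity
  have hy1 : y ≤ 1 / 2 := by rw [hy, div_le_iff₀ h2]; linarith
  -- `v` and `w` are `n - 2` times the drop of the split weight in the two terms.
  set v := (n - k) * (2 * n * (n - 1) - k * (4 * n - 6)) / (n * (n - 1) * (n - 3)) with hv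
  set w := k * (2 * n * (n - 1) - (n - k) * (4 * n - 6)) / (n * (n - 1) * (n - 3)) with hw
  have e1 : -(1 / 4 * x * splitWeight (n - 2) (k - 2)) =
      -(1 / 4 * x * g) + 1 / 4 * (y * v) := by
    simp only [hg, hy, hv, splitWeight]
    have : n - 2 - 1 = n - 3 := by ring
    rw [this]; field_simp; ring
  have e2 : -(1 / 4 * x * splitWeight (n - 2) k) = -(1 / 4 * x * g) + 1 / 4 * (y * w) := by
    simp only [hg, hy, hw, splitWeight]
    have : n - 2 - 1 = n - 3 := by ring
    rw [this]; field_simp; ring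
  have e3 : -(1 / 4 * (x + 1) * g) = -(1 / 4 * x * g) + -(1 / 4 * g) := by ring
  have hA : ∀ t : ℝ, 0 ≤ t → t ≤ n →
      |2 * n * (n - 1) - t * (4 * n - 6)| ≤ 2 * n * (n - 1) := by
    intro t ht htn
    rw [abs_le]; constructor <;> nlinarith
  have hvb : |v| ≤ 2 * (n - k) / (n - 3) := by
    have : 0 < n * (n - 1) * (n - 3) := by positivity
    rw [hv, abs_div, abs_mul, abs_of_nonneg hkn, abs_of_pos this, div_le_div_iff₀ this h3]
    have := mul_le_mul_of_nonneg_left (hA k hk0 (by linarith)) (mul_nonneg hkn h3.le)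
    nlinarith
  have hwb : |w| ≤ 2 * (n - (n - k)) / (n - 3) := by
    have : 0 < n * (n - 1) * (n - 3) := by positivity
    rw [hw, abs_div, abs_mul, abs_of_nonneg hk0, abs_of_pos this, div_le_div_iff₀ this h3]
    have := mul_le_mul_of_nonneg_left (hA (n - k) hkn (by linarith)) (mul_nonneg hk0 h3.le)
    nlinarith
  have b1 := mul_exp_le_quadratic hn hk (by linarith) hy0 hy1 hvb
  have b2 := mul_exp_le_quadratic hn hk' (by linarith) hy0 hy1 hwb
  have hmix : k * (k - 1) * v + (n - k) * (n - k - 1) * w ≤ k * (n - k) * (2 / 3) * 2 := by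
    have e : k * (k - 1) * v + (n - k) * (n - k - 1) * w =
        k * (n - k) * (2 * (k * (n - k) * (4 * n - 6) - n * (n - 1) ^ 2) /
          (n * (n - 1) * (n - 3))) := by
      simp only [hv, hw]; field_simp; ring
    rw [e]
    have : 2 * (k * (n - k) * (4 * n - 6) - n * (n - 1) ^ 2) / (n * (n - 1) * (n - 3)) ≤
        (2 / 3) * 2 := by
      rw [div_le_iff₀ (by positivity)]
      have hs : k * (n - k) ≤ n ^ 2 / 4 := by nlinarith [sq_nonneg (n - 2 * k)]
      have := mul_le_mul_of_nonneg_right hs (by linarith : 0 ≤ 4 * n - 6)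
      nlinarith [mul_pos h0 h3, mul_pos (mul_pos h0 h1) h3]
    have hkk := mul_nonneg hk0 hkn
    linarith [mul_le_mul_of_nonneg_left this hkk]
  have hgn : n * (n - 1) * g = k * (n - k) := by
    simp only [hg, splitWeight]; field_simp
  clear_value g y v w
  have hmix' : k * (k - 1) * (1 / 4 * (y * v)) + (n - k) * (n - k - 1) * (1 / 4 * (y * w)) ≤
      k * (n - k) * (1 / 6) := by
    have e : k * (k - 1) * (1 / 4 * (y * v)) + (n - k) * (n - k - 1) * (1 / 4 * (y * w)) =
      1 / 4 * (y * (k * (k - 1) * v + (n - k) * (n - k - 1) * w)) := by ring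
    have hkk := mul_nonneg hk0 hkn
    rw [e]
    have h4 := mul_le_mul_of_nonneg_left hmix hy0
    have h5 := mul_le_mul_of_nonneg_right hy1 hkk
    generalize k * (k - 1) * v + (n - k) * (n - k - 1) * w = M at h4 ⊢
    linarith
  have hE : n * (n - 1) * (1 - 1 / 4 * g) ≤ n * (n - 1) * Real.exp (-(1 / 4 * g)) := by
    have := Real.add_one_le_exp (-(1 / 4 * g))
    have hnn : 0 ≤ n * (n - 1) := by positivity
    apply mul_le_mul_of_nonneg_left _ hnn
    linarith
  have hkk := mul_nonneg hk0 hkn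
  rw [e1, e2, e3, Real.exp_add, Real.exp_add, Real.exp_add]
  have key : k * (k - 1) * Real.exp (1 / 4 * (y * v)) +
      (n - k) * (n - k - 1) * Real.exp (1 / 4 * (y * w)) ≤
      n * (n - 1) * Real.exp (-(1 / 4 * g)) := by
    have hE' : n * (n - 1) - 1 / 4 * (k * (n - k)) ≤ n * (n - 1) * Real.exp (-(1 / 4 * g)) := by
      rw [← hgn]; linarith
    refine le_trans ?_ hE'
    linarith
  have := mul_le_mul_of_nonneg_left key (Real.exp_pos (-(1 / 4 * x * g))).le
  linarith

theorem choose_sub_two_mul (n k : ℕ) :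
    (n.choose k : ℝ) * ((n + 2) * (n + 1)) =
      ((n + 2).choose k : ℝ) * ((n + 2 - k) * (n + 2 - k - 1)) := by
  have a (m : ℕ) : (m.choose k : ℝ) * (m + 1) = ((m + 1).choose k : ℝ) * (m + 1 - k) := by
    rcases le_or_gt k (m + 1) with h | h
    · have := Nat.choose_mul_succ_eq m k
      have := congrArg (Nat.cast : ℕ → ℝ) this
      rw [Nat.cast_mul, Nat.cast_mul, Nat.cast_sub h] at this
      push_cast at this
      exact this
    · rw [Nat.choose_eq_zero_of_lt h, Nat.choose_eq_zero_of_lt (by omega)]; simp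
  have h1 := a n
  have h2 := a (n + 1)
  push_cast at h2
  linear_combination (n + 2 : ℝ) * h1 + (n + 1 - k : ℝ) * h2

theorem choose_add_two_mul (n k : ℕ) :
    (n.choose k : ℝ) * ((n + 2) * (n + 1)) =
      ((n + 2).choose (k + 2) : ℝ) * ((k + 2) * (k + 1)) := by
  have h1 := congrArg (Nat.cast : ℕ → ℝ) (Nat.add_one_mul_choose_eq n k)
  have h2 := congrArg (Nat.cast : ℕ → ℝ) (Nat.add_one_mul_choose_eq (n + 1) (k + 1))
  push_cast at h1 h2
  linear_combination (n + 2 : ℝ) * h1 + (k + 1 : ℝ) * h2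

theorem nat_zero_or_one_or_two_le (k : ℕ) : (k : ℝ) = 0 ∨ (k : ℝ) = 1 ∨ (2 : ℝ) ≤ k := by
  rcases k with _ | _ | k
  · simp
  · simp
  · right; right; push_cast; linarith [(Nat.cast_nonneg k : (0 : ℝ) ≤ k)]

/-- Divided by `(n + 2).choose k`, the two binomials are the probabilities that a random `k`-subset
of `n + 2` points contains, respectively avoids, a fixed pair. -/
theorem splitWeight_step_nat (n k x : ℕ) (hx : 2 * x ≤ n) :
    ((if 2 ≤ k then (n.choose (k - 2) : ℝ) else 0) *
        Real.exp (-(1 / 4 * x * splitWeight n (k - 2)))) +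
      (n.choose k : ℝ) * Real.exp (-(1 / 4 * x * splitWeight n k)) ≤
      ((n + 2).choose k : ℝ) * Real.exp (-(1 / 4 * (x + 1) * splitWeight (n + 2) k)) := by
  rcases lt_or_ge (n + 2) k with hkn | hkn
  · rw [Nat.choose_eq_zero_of_lt hkn, Nat.choose_eq_zero_of_lt (by omega : n < k - 2),
      Nat.choose_eq_zero_of_lt (by omega : n < k)]
    simp
  have hN : (0 : ℝ) < (n + 2) * (n + 1) := by positivity
  have hif : (if 2 ≤ k then (n.choose (k - 2) : ℝ) else 0) * ((n + 2) * (n + 1)) =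
      ((n + 2).choose k : ℝ) * (k * (k - 1)) := by
    rcases k with _ | _ | k
    · simp
    · simp
    · have := choose_add_two_mul n k
      have e : k + 1 + 1 - 2 = k := by omega
      simp only [le_add_iff_nonneg_left, zero_le, if_true, e]
      rw [this]; push_cast; ring
  have hno := choose_sub_two_mul n k
  have key : (k : ℝ) * (k - 1) * Real.exp (-(1 / 4 * x * splitWeight n (k - 2))) +
      (n + 2 - k) * (n + 2 - k - 1) * Real.exp (-(1 / 4 * x * splitWeight n k)) ≤
      (n + 2) * (n + 1) * Real.exp (-(1 / 4 * (x + 1) * splitWeight (n + 2) k)) := by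
    have hkn' : (k : ℝ) ≤ n + 2 := by exact_mod_cast hkn
    have hk0 : (0 : ℝ) ≤ k := Nat.cast_nonneg k
    -- The real inequality needs at least 4 points, which `x ≥ 1` guarantees; for `x = 0` the bound
    -- `1 + t ≤ exp t` is enough.
    rcases Nat.eq_zero_or_pos x with rfl | hx1
    · have hE := Real.add_one_le_exp (-(1 / 4 * (0 + 1) * splitWeight (n + 2) k))
      have hg : ((n : ℝ) + 2) * (n + 1) * splitWeight (n + 2) k = k * (n + 2 - k) := by
        have : (n : ℝ) + 2 - 1 = n + 1 := by ring
        rw [splitWeight, this]; field_simp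
      have := mul_le_mul_of_nonneg_left hE hN.le
      simp only [Nat.cast_zero, mul_zero, zero_mul, neg_zero, Real.exp_zero]
      nlinarith [mul_nonneg hk0 (sub_nonneg.2 hkn')]
    · have h4 : (4 : ℝ) ≤ n + 2 := by
        have : 2 ≤ n := by omega
        have : (2 : ℝ) ≤ n := by exact_mod_cast this
        linarith
      have := splitWeight_step (n := (n : ℝ) + 2) (k := k) (x := x) h4 (Nat.cast_nonneg x)
        (by have : (2 : ℝ) * x ≤ n := by exact_mod_cast hx
            linarith)
        (nat_zero_or_one_or_two_le k)
        (by have := nat_zero_or_one_or_two_le (n + 2 - k)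
            rw [Nat.cast_sub hkn] at this
            push_cast at this
            exact this)
      have e1 : (n : ℝ) + 2 - 2 = n := by ring
      have e2 : (n : ℝ) + 2 - 1 = n + 1 := by ring
      rw [e1, e2] at this
      exact this
  have h := mul_le_mul_of_nonneg_left key (Nat.cast_nonneg ((n + 2).choose k) : (0 : ℝ) ≤ _)
  refine le_of_mul_le_mul_right ?_ hN
  rw [add_mul, mul_right_comm, hif, mul_right_comm (n.choose k : ℝ), hno]
  linarith

open Polynomial in
-- Induction on the number of factors `1 - X^2`, each handled by the triangle inequality. All `k`
-- are allowed, since `2 * k ≤ n` would not survive lowering `n` by 2.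
theorem abs_coeff_one_sub_sq_pow_mul_le (m x k : ℕ) :
    |((1 - X ^ 2 : ℝ[X]) ^ x * (1 + X) ^ m).coeff k| ≤
      ((m + 2 * x).choose k : ℝ) *
        Real.exp (-(1 / 4 * x * splitWeight ((m + 2 * x : ℕ) : ℝ) k)) := by
  induction x generalizing k with
  | zero => simp [coeff_one_add_X_pow]
  | succ x ih =>
    have hrec : ((1 - X ^ 2 : ℝ[X]) ^ (x + 1) * (1 + X) ^ m) =
        (1 - X ^ 2 : ℝ[X]) ^ x * (1 + X) ^ m - X ^ 2 * ((1 - X ^ 2 : ℝ[X]) ^ x * (1 + X) ^ m) := by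
      ring
    rw [hrec, coeff_sub, coeff_X_pow_mul']
    have hs := splitWeight_step_nat (m + 2 * x) k x (by omega)
    have e : m + 2 * (x + 1) = m + 2 * x + 2 := by ring
    rw [e]
    push_cast at hs ih ⊢
    refine le_trans ?_ hs
    refine (abs_sub _ _).trans ?_
    rw [add_comm]
    refine add_le_add ?_ (ih k)
    split_ifs with h
    · have := ih (k - 2)
      rw [Nat.cast_sub h] at this
      exact this
    · simp

open Polynomial in
theorem isKrawtchoukConstant_one_eighth : IsKrawtchoukConstant (1 / 8) := by
  refine ⟨by norm_num, by norm_num, fun n k x hk hx => ?_⟩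
  obtain ⟨m, rfl⟩ : ∃ m, n = m + 2 * x := ⟨n - 2 * x, by omega⟩
  rw [krawtchouk_eq_coeff]
  have e : (1 - X : ℝ[X]) ^ x * (1 + X) ^ (m + 2 * x - x) = (1 - X ^ 2) ^ x * (1 + X) ^ m := by
    have : m + 2 * x - x = x + m := by omega
    rw [this, pow_add, ← mul_assoc, ← mul_pow]
    ring
  rw [e, abs_mul, abs_inv, Nat.abs_cast]
  have h := abs_coeff_one_sub_sq_pow_mul_le m x k
  set n := m + 2 * x with hn
  have hpos : (0 : ℝ) < n.choose k := by
    exact_mod_cast Nat.choose_pos (by omega)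
  rw [inv_mul_le_iff₀ hpos]
  refine h.trans ?_
  gcongr
  have hk' : (2 : ℝ) * k ≤ n := by exact_mod_cast hk
  rcases Nat.eq_zero_or_pos k with rfl | hk1
  · simp [splitWeight]
  have hk1' : (1 : ℝ) ≤ k := by exact_mod_cast hk1
  have hx0 : (0 : ℝ) ≤ x := Nat.cast_nonneg x
  have hn1 : (0 : ℝ) < n - 1 := by linarith
  have hn0 : (0 : ℝ) < n := by linarith
  -- Here `n - k ≥ n/2`, which turns the rate `1/4` into `1/8`.
  have hg : (k : ℝ) / (2 * n) ≤ splitWeight n k := by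
    rw [splitWeight, div_le_div_iff₀ (by positivity) (by positivity)]
    nlinarith [mul_pos hn0 (by linarith : (0 : ℝ) < k)]
  calc 1 / 8 * (k : ℝ) * x / n = 1 / 4 * x * (k / (2 * n)) := by field_simp; ring
    _ ≤ _ := by gcongr

/-! ### Averaging Krawtchouk values over random subsets -/

open Polynomial in
-- Substituting `-X` for `X` exchanges the two factors and multiplies the coefficient by `(-1)^k`.
theorem abs_krawtchouk_reflect {n k x : ℕ} (hx : x ≤ n) :
    |krawtchouk n k (n - x)| = |krawtchouk n k x| := by
  have h : (1 - X : ℝ[X]) ^ (n - x) * (1 + X) ^ (n - (n - x)) =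
      ((1 - X : ℝ[X]) ^ x * (1 + X) ^ (n - x)).comp (C (-1) * X) := by
    rw [Nat.sub_sub_self hx]
    simp [sub_eq_add_neg, mul_comm]
  rw [krawtchouk_eq_coeff, krawtchouk_eq_coeff, h, comp_C_mul_X_coeff]
  simp [abs_mul]

theorem IsKrawtchoukConstant.abs_krawtchouk_le {c : ℝ} (hc : IsKrawtchoukConstant c) {n k : ℕ}
    (hk : 2 * k ≤ n) {u : ℕ} (hu : u ≤ n) :
    |krawtchouk n k u| ≤
      Real.exp (-(c * k / n)) ^ u + Real.exp (-(c * k / n)) ^ (n - u) := by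
  have key : ∀ v : ℕ, 2 * v ≤ n → |krawtchouk n k v| ≤ Real.exp (-(c * k / n)) ^ v := by
    intro v hv
    rw [← Real.exp_nat_mul]
    refine (hc.2.2 n k v hk hv).trans_eq ?_
    congr 1; ring
  have hpos : ∀ v : ℕ, 0 ≤ Real.exp (-(c * k / n)) ^ v := fun v => by positivity
  rcases le_total (2 * u) n with h | h
  · linarith [key u h, hpos (n - u)]
  · rw [← abs_krawtchouk_reflect hu]
    linarith [key (n - u) (by omega), hpos u]

open Polynomial in
-- Choose `t ⊆ I` by including each `i` independently with probability `p i`. The product is the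
-- expectation of `(1 - X)^|t| (1 + X)^(|I| - |t|)`, whose coefficients are Krawtchouk values, and
-- the expectations of `θ^|t|` and `θ^(|I| - |t|)` factor over `i`.
theorem abs_coeff_prod_one_add_le {ι : Type*} [DecidableEq ι] (I : Finset ι) (p : ι → ℝ)
    (hp0 : ∀ i, 0 ≤ p i) (hp1 : ∀ i, p i ≤ 1) {k : ℕ} (hk : k ≤ I.card) {θ : ℝ}
    (hK : ∀ u ≤ I.card, |krawtchouk I.card k u| ≤ θ ^ u + θ ^ (I.card - u)) :
    |(∏ i ∈ I, (1 + C (1 - 2 * p i) * X) : ℝ[X]).coeff k| ≤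
      (I.card.choose k : ℝ) *
        (∏ i ∈ I, (p i * θ + (1 - p i)) + ∏ i ∈ I, (p i + (1 - p i) * θ)) := by
  have hpos : (0 : ℝ) < I.card.choose k := by exact_mod_cast Nat.choose_pos hk
  have h1 : ∀ i, (1 + C (1 - 2 * p i) * X : ℝ[X]) =
      C (p i) * (1 - X) + C (1 - p i) * (1 + X) := by
    intro i
    simp only [C_sub, C_mul, C_1]
    have : (C 2 : ℝ[X]) = 2 := rfl
    rw [this]; ring
  simp only [h1]
  rw [Finset.prod_add, finsetSum_coeff, Finset.prod_add, Finset.prod_add,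
    ← Finset.sum_add_distrib, Finset.mul_sum]
  refine (Finset.abs_sum_le_sum_abs _ _).trans (Finset.sum_le_sum fun t ht => ?_)
  have htI := Finset.mem_powerset.1 ht
  have hcard : (I \ t).card = I.card - t.card := Finset.card_sdiff_of_subset htI
  have htc : t.card ≤ I.card := Finset.card_le_card htI
  simp only [Finset.prod_mul_distrib, Finset.prod_const, hcard]
  rw [← map_prod, ← map_prod]
  have e : C (∏ i ∈ t, p i) * (1 - X : ℝ[X]) ^ t.card *
      (C (∏ i ∈ I \ t, (1 - p i)) * (1 + X) ^ (I.card - t.card)) =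
      C ((∏ i ∈ t, p i) * ∏ i ∈ I \ t, (1 - p i)) *
        ((1 - X : ℝ[X]) ^ t.card * (1 + X) ^ (I.card - t.card)) := by
    rw [C_mul]; ring
  have hkr := krawtchouk_eq_coeff I.card k t.card
  rw [eq_inv_mul_iff_mul_eq₀ hpos.ne'] at hkr
  rw [e, coeff_C_mul, ← hkr, abs_mul, abs_mul (I.card.choose k : ℝ), abs_of_pos hpos]
  have hA : 0 ≤ (∏ i ∈ t, p i) * ∏ i ∈ I \ t, (1 - p i) :=
    mul_nonneg (Finset.prod_nonneg fun i _ => hp0 i)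
      (Finset.prod_nonneg fun i _ => sub_nonneg.2 (hp1 i))
  rw [abs_of_nonneg hA]
  calc _ ≤ (∏ i ∈ t, p i) * (∏ i ∈ I \ t, (1 - p i)) *
        ((I.card.choose k : ℝ) * (θ ^ t.card + θ ^ (I.card - t.card))) := by
        gcongr
        exact hK _ htc
    _ = _ := by ring

/-! ### Fibres of the sphere with prescribed big coordinates -/

/-- The square of the Euclidean norm of an integer vector, as a natural number. -/
def intNormSq {d : ℕ} (x : Fin d → ℤ) : ℕ := ∑ i, (x i).natAbs ^ 2

theorem intNormSq_cast {d : ℕ} (x : Fin d → ℤ) : (intNormSq x : ℤ) = ∑ i, x i ^ 2 := by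
  simp [intNormSq]

theorem mem_latticeSphere_iff_intNormSq {d lam : ℕ} {x : Fin d → ℤ} :
    x ∈ latticeSphere d lam ↔ intNormSq x = lam := by
  rw [mem_latticeSphere, ← intNormSq_cast, Nat.cast_inj]

/-- The character `x ↦ exp(2πi ξ·x)` of `ℤ^d`. -/
noncomputable def latticeChar {d : ℕ} (ξ : Fin d → ℝ) (x : Fin d → ℤ) : ℂ :=
  Complex.exp (2 * (Real.pi : ℂ) * Complex.I * ((∑ i, ξ i * (x i : ℝ) : ℝ) : ℂ))

theorem latticeChar_eq_prod {d : ℕ} (ξ : Fin d → ℝ) (x : Fin d → ℤ) :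
    latticeChar ξ x =
      ∏ i, Complex.exp (2 * (Real.pi : ℂ) * Complex.I * ((ξ i : ℂ) * (x i : ℂ))) := by
  rw [latticeChar, ← Complex.exp_sum]
  push_cast
  rw [Finset.mul_sum]

theorem norm_latticeChar {d : ℕ} (ξ : Fin d → ℝ) (x : Fin d → ℤ) : ‖latticeChar ξ x‖ = 1 := by
  rw [latticeChar, mul_right_comm, ← Complex.norm_exp_ofReal_mul_I
    (2 * Real.pi * ∑ i, ξ i * (x i : ℝ))]
  push_cast
  rfl

/-- The coordinate `j` if `|j| ≥ 2`, and zero otherwise. -/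
def bigPart (j : ℤ) : ℤ := if 2 ≤ |j| then j else 0

/-- The integers whose big part is `y`, when `y` is a big part. -/
def bigPartFiber (y : ℤ) : Finset ℤ := if y = 0 then {-1, 0, 1} else {y}

theorem mem_bigPartFiber {y j : ℤ} (hy : bigPart y = y) :
    j ∈ bigPartFiber y ↔ bigPart j = y := by
  unfold bigPartFiber bigPart at *
  split_ifs at hy ⊢ with h1 h2 h3 <;> simp <;> grind

theorem bigPart_bigPart (j : ℤ) : bigPart (bigPart j) = bigPart j := by
  unfold bigPart; split_ifs <;> simp_all

/-- The points of a sphere with prescribed big parts. -/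
noncomputable def sphereFiber {d : ℕ} (lam : ℕ) (y : Fin d → ℤ) : Finset (Fin d → ℤ) :=
  (Fintype.piFinset fun i => bigPartFiber (y i)).filter fun x => intNormSq x = lam

theorem filter_latticeSphere_eq_sphereFiber {d lam : ℕ} {y : Fin d → ℤ}
    (hy : ∀ i, bigPart (y i) = y i) :
    (latticeSphere d lam).filter (fun x => (fun i => bigPart (x i)) = y) = sphereFiber lam y := by
  ext x
  simp only [sphereFiber, Finset.mem_filter, mem_latticeSphere_iff_intNormSq,
    Fintype.mem_piFinset, mem_bigPartFiber (hy _), funext_iff]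
  tauto

open Polynomial in
-- Marking a coordinate value `j` by `X^(j²)` makes the generating function of the fibre a product
-- over coordinates; extracting degree `k + intNormSq y` imposes the sphere equation.
theorem sum_latticeChar_sphereFiber {d : ℕ} (ξ : Fin d → ℝ) (y : Fin d → ℤ) (k : ℕ) :
    ∑ x ∈ sphereFiber (k + intNormSq y) y, latticeChar ξ x =
      latticeChar ξ y *
        (((∏ i ∈ Finset.univ.filter (fun i => y i = 0),
          (1 + C (2 * Real.cos (2 * Real.pi * ξ i)) * X) : ℝ[X]).coeff k : ℝ) : ℂ) := by
  set f : Fin d → ℤ → ℂ[X] := fun i j =>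
    C (Complex.exp (2 * (Real.pi : ℂ) * Complex.I * ((ξ i : ℂ) * (j : ℂ)))) * X ^ (j.natAbs ^ 2)
    with hf
  have hprod : ∀ x : Fin d → ℤ, ∏ i, f i (x i) = C (latticeChar ξ x) * X ^ intNormSq x := by
    intro x
    simp only [hf, Finset.prod_mul_distrib, Finset.prod_pow_eq_pow_sum, latticeChar_eq_prod,
      map_prod, intNormSq]
  have h1 : ∑ x ∈ sphereFiber (k + intNormSq y) y, latticeChar ξ x =
      (∏ i, ∑ j ∈ bigPartFiber (y i), f i j).coeff (k + intNormSq y) := by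
    rw [Finset.prod_univ_sum, finsetSum_coeff, sphereFiber, Finset.sum_filter]
    refine Finset.sum_congr rfl fun x _ => ?_
    rw [hprod, coeff_C_mul, coeff_X_pow]
    simp only [mul_ite, mul_one, mul_zero, eq_comm]
  -- The extra factor `f i (y i)` is `1` here; keeping it lets the monomials recombine over all
  -- coordinates.
  have h0 : ∀ i ∈ Finset.univ.filter (fun i => y i = 0),
      ∑ j ∈ bigPartFiber (y i), f i j =
        mapRingHom Complex.ofRealHom (1 + C (2 * Real.cos (2 * Real.pi * ξ i)) * X) * f i (y i) := by
    intro i hi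
    have hi0 := (Finset.mem_filter.1 hi).2
    have : bigPartFiber (y i) = {-1, 0, 1} := by simp [bigPartFiber, hi0]
    rw [this, hi0, Finset.sum_insert (by decide), Finset.sum_insert (by decide),
      Finset.sum_singleton]
    simp only [hf, coe_mapRingHom, Polynomial.map_add, Polynomial.map_mul, map_C, map_X,
      Polynomial.map_one, Complex.ofRealHom_eq_coe]
    push_cast
    rw [Complex.two_cos]
    have e1 : 2 * (Real.pi : ℂ) * Complex.I * ((ξ i : ℂ) * -1) =
      -(2 * (Real.pi : ℂ) * (ξ i : ℂ)) * Complex.I := by ring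
    have e2 : 2 * (Real.pi : ℂ) * Complex.I * ((ξ i : ℂ) * 1) =
      (2 * (Real.pi : ℂ) * (ξ i : ℂ)) * Complex.I := by ring
    rw [e1, e2, C_add]
    simp
    ring
  have h2 : ∀ i ∈ Finset.univ.filter (fun i => ¬ y i = 0),
      ∑ j ∈ bigPartFiber (y i), f i j = f i (y i) := by
    intro i hi
    simp [bigPartFiber, (Finset.mem_filter.1 hi).2]
  rw [h1, ← Finset.prod_filter_mul_prod_filter_not Finset.univ (fun i => y i = 0),
    Finset.prod_congr rfl h0, Finset.prod_congr rfl h2, Finset.prod_mul_distrib, mul_assoc,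
    Finset.prod_filter_mul_prod_filter_not, hprod, ← map_prod, mul_left_comm, coeff_C_mul,
    coeff_mul_X_pow, coe_mapRingHom, coeff_map]
  rfl

open Polynomial in
theorem coeff_prod_one_add_two_mul {ι : Type*} (I : Finset ι) (a : ι → ℝ) (k : ℕ) :
    (∏ i ∈ I, (1 + C (2 * a i) * X) : ℝ[X]).coeff k =
      2 ^ k * (∏ i ∈ I, (1 + C (a i) * X) : ℝ[X]).coeff k := by
  have h : (∏ i ∈ I, (1 + C (2 * a i) * X) : ℝ[X]) =
      (∏ i ∈ I, (1 + C (a i) * X) : ℝ[X]).comp (C 2 * X) := by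
    rw [prod_comp]
    refine Finset.prod_congr rfl fun i _ => ?_
    simp only [add_comp, one_comp, mul_comp, C_comp, X_comp, C_mul]
    ring
  rw [h, comp_C_mul_X_coeff, mul_comm]

theorem card_sphereFiber {d : ℕ} (y : Fin d → ℤ) (k : ℕ) :
    ((sphereFiber (k + intNormSq y) y).card : ℝ) =
      2 ^ k * ((Finset.univ.filter (fun i => y i = 0)).card.choose k : ℝ) := by
  have h := sum_latticeChar_sphereFiber 0 y k
  rw [coeff_prod_one_add_two_mul] at h
  simp [latticeChar, Polynomial.coeff_one_add_X_pow] at h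
  exact_mod_cast h

/-- The exponential sum over the points of a sphere with prescribed big parts. -/
theorem IsKrawtchoukConstant.norm_sum_sphereFiber_le {c : ℝ} (hc : IsKrawtchoukConstant c)
    {d k : ℕ} (ξ : Fin d → ℝ) (y : Fin d → ℤ) {I : Finset (Fin d)}
    (hI : Finset.univ.filter (fun i => y i = 0) = I) (hk : 2 * k ≤ I.card) :
    ‖∑ x ∈ sphereFiber (k + intNormSq y) y, latticeChar ξ x‖ ≤
      ((sphereFiber (k + intNormSq y) y).card : ℝ) *
        (Real.exp (-((1 - Real.exp (-(c * k / I.card))) *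
            ∑ i ∈ I, Real.sin (Real.pi * ξ i) ^ 2)) +
          Real.exp (-((1 - Real.exp (-(c * k / I.card))) *
            ∑ i ∈ I, Real.cos (Real.pi * ξ i) ^ 2))) := by
  rw [sum_latticeChar_sphereFiber, card_sphereFiber, norm_mul, norm_latticeChar, one_mul,
    Complex.norm_real, Real.norm_eq_abs, coeff_prod_one_add_two_mul, abs_mul,
    abs_of_pos (by positivity : (0 : ℝ) < 2 ^ k), hI, mul_assoc]
  set θ := Real.exp (-(c * k / I.card)) with hθ
  have hcos : ∀ i, Real.cos (2 * Real.pi * ξ i) = 1 - 2 * Real.sin (Real.pi * ξ i) ^ 2 := by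
    intro i
    rw [mul_assoc, Real.cos_two_mul, Real.cos_sq']; ring
  -- By `hcos`, the inclusion probability is `sin²(πξ_i)`.
  have h := abs_coeff_prod_one_add_le I (fun i => Real.sin (Real.pi * ξ i) ^ 2)
    (fun i => sq_nonneg _) (fun i => Real.sin_sq_le_one _) (by omega : k ≤ I.card)
    (fun u hu => hc.abs_krawtchouk_le hk hu)
  simp only [hcos]
  gcongr
  refine h.trans ?_
  have hprod : ∀ (a b : Fin d → ℝ), (∀ i, a i ≤ Real.exp (-((1 - θ) * b i))) →
      (∀ i, 0 ≤ a i) → ∏ i ∈ I, a i ≤ Real.exp (-((1 - θ) * ∑ i ∈ I, b i)) := by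
    intro a b hab ha
    rw [Finset.mul_sum, ← Finset.sum_neg_distrib, Real.exp_sum]
    exact Finset.prod_le_prod (fun i _ => ha i) fun i _ => hab i
  have hθ0 : 0 < θ := Real.exp_pos _
  gcongr
  · refine hprod _ (fun i => Real.sin (Real.pi * ξ i) ^ 2) (fun i => ?_)
      (fun i => ?_)
    · refine le_trans (le_of_eq ?_) (Real.add_one_le_exp _)
      rw [← hθ]; ring
    · have := Real.sin_sq_le_one (Real.pi * ξ i)
      have : 0 ≤ 1 - Real.sin (Real.pi * ξ i) ^ 2 := by linarith
      positivity
  · refine hprod _ (fun i => Real.cos (Real.pi * ξ i) ^ 2) (fun i => ?_)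
      (fun i => ?_)
    · refine le_trans (le_of_eq ?_) (Real.add_one_le_exp _)
      rw [← hθ, Real.cos_sq']; ring
    · have := Real.sin_sq_le_one (Real.pi * ξ i)
      have : 0 ≤ 1 - Real.sin (Real.pi * ξ i) ^ 2 := by linarith
      positivity

/-! ### Averaging big supports by permutation symmetry -/

/-- The coordinates at which a vector has a nonzero big part. -/
def bigSupport {d : ℕ} (x : Fin d → ℤ) : Finset (Fin d) :=
  Finset.univ.filter fun i => ¬ bigPart (x i) = 0

theorem mem_bigSupport {d : ℕ} {x : Fin d → ℤ} {i : Fin d} :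
    i ∈ bigSupport x ↔ bigPart (x i) ≠ 0 := by
  simp [bigSupport]

theorem card_filter_insert_subset_bigSupport_swap {d : ℕ} {G : Finset (Fin d → ℤ)}
    (hG : ∀ x ∈ G, ∀ σ : Equiv.Perm (Fin d), x ∘ σ ∈ G) {L : Finset (Fin d)} {i j : Fin d}
    (hi : i ∉ L) (hj : j ∉ L) :
    (G.filter fun x => insert i L ⊆ bigSupport x).card =
      (G.filter fun x => insert j L ⊆ bigSupport x).card := by
  have key : ∀ {i j : Fin d}, i ∉ L → j ∉ L → ∀ x ∈ G.filter (fun x => insert i L ⊆ bigSupport x),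
      x ∘ Equiv.swap i j ∈ G.filter (fun x => insert j L ⊆ bigSupport x) := by
    intro i j hi hj x hx
    rw [Finset.mem_filter, Finset.insert_subset_iff] at hx ⊢
    refine ⟨hG x hx.1 _, ?_, fun l hl => ?_⟩
    · have := hx.2.1
      rw [mem_bigSupport] at this ⊢
      simpa using this
    · have := hx.2.2 hl
      rw [mem_bigSupport] at this ⊢
      rw [Function.comp_apply, Equiv.swap_apply_of_ne_of_ne]
      · exact this
      · rintro rfl; exact hi hl
      · rintro rfl; exact hj hl
  refine Finset.card_nbij' (fun x => x ∘ Equiv.swap i j) (fun x => x ∘ Equiv.swap j i)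
    (key hi hj) (key hj hi) (fun x _ => ?_) (fun x _ => ?_)
  · funext l; simp [Equiv.swap_comm j i]
  · funext l; simp [Equiv.swap_comm j i]

/-- By symmetry the count is the same for every `i ∉ L`, so average over `i`: a support containing
`L` has at most `μd - |L| ≤ μ(d - |L|)` further elements, as `μ ≤ 1`. -/
theorem card_filter_insert_subset_bigSupport_le {d : ℕ} {G : Finset (Fin d → ℤ)}
    (hG : ∀ x ∈ G, ∀ σ : Equiv.Perm (Fin d), x ∘ σ ∈ G) {μ : ℝ} (hμ : μ ≤ 1)
    (hB : ∀ x ∈ G, ((bigSupport x).card : ℝ) ≤ μ * d) {L : Finset (Fin d)} {i : Fin d}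
    (hi : i ∉ L) :
    ((G.filter fun x => insert i L ⊆ bigSupport x).card : ℝ) ≤
      μ * (G.filter fun x => L ⊆ bigSupport x).card := by
  set W := G.filter fun x => L ⊆ bigSupport x with hW
  have hins : ∀ j, (G.filter fun x => insert j L ⊆ bigSupport x) =
      W.filter fun x => j ∈ bigSupport x := by
    intro j
    rw [hW, Finset.filter_filter]
    simp only [Finset.insert_subset_iff, and_comm]
  have hdouble : ∑ j ∈ Lᶜ, (G.filter fun x => insert j L ⊆ bigSupport x).card =
      ∑ x ∈ W, (bigSupport x \ L).card := by
    simp only [hins]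
    refine (Finset.sum_card_bipartiteAbove_eq_sum_card_bipartiteBelow
      (s := W) (t := Lᶜ) (fun x j => j ∈ bigSupport x)).symm.trans ?_
    refine Finset.sum_congr rfl fun x _ => ?_
    congr 1
    ext j
    simp [Finset.bipartiteAbove, and_comm]
  rw [Finset.sum_congr rfl fun j hj => card_filter_insert_subset_bigSupport_swap hG
    (Finset.mem_compl.1 hj) hi, Finset.sum_const, smul_eq_mul, Finset.card_compl,
    Fintype.card_fin] at hdouble
  have hL : L.card < d := by
    have := Finset.card_lt_card (Finset.ssubset_univ_iff.2 (fun h : L = Finset.univ => by simp [h] at hi))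
    simpa using this
  have hdouble' := congrArg (Nat.cast : ℕ → ℝ) hdouble
  rw [Nat.cast_mul, Nat.cast_sub hL.le, Nat.cast_sum] at hdouble'
  have hL' : (0 : ℝ) < d - L.card := by
    have : (L.card : ℝ) < d := by exact_mod_cast hL
    linarith
  refine le_of_mul_le_mul_left ?_ hL'
  rw [hdouble']
  calc ∑ x ∈ W, ((bigSupport x \ L).card : ℝ) ≤ ∑ x ∈ W, μ * (d - L.card) := by
        refine Finset.sum_le_sum fun x hx => ?_
        have hx' := Finset.mem_filter.1 hx
        rw [Finset.card_sdiff_of_subset hx'.2, Nat.cast_sub (Finset.card_le_card hx'.2)]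
        have := hB x hx'.1
        nlinarith [(Nat.cast_nonneg L.card : (0 : ℝ) ≤ _)]
    _ = _ := by rw [Finset.sum_const, nsmul_eq_mul]; ring

theorem card_filter_subset_bigSupport_le {d : ℕ} {G : Finset (Fin d → ℤ)}
    (hG : ∀ x ∈ G, ∀ σ : Equiv.Perm (Fin d), x ∘ σ ∈ G) {μ : ℝ} (hμ0 : 0 ≤ μ) (hμ : μ ≤ 1)
    (hB : ∀ x ∈ G, ((bigSupport x).card : ℝ) ≤ μ * d) (L : Finset (Fin d)) :
    ((G.filter fun x => L ⊆ bigSupport x).card : ℝ) ≤ μ ^ L.card * G.card := by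
  induction L using Finset.induction_on with
  | empty => simp
  | insert i L hi ih =>
    refine (card_filter_insert_subset_bigSupport_le hG hμ hB hi).trans ?_
    rw [Finset.card_insert_of_notMem hi, pow_succ', mul_assoc]
    gcongr

/-- In a permutation-invariant family, the big supports are spread out evenly. -/
theorem sum_prod_bigSupport_le {d : ℕ} {G : Finset (Fin d → ℤ)}
    (hG : ∀ x ∈ G, ∀ σ : Equiv.Perm (Fin d), x ∘ σ ∈ G) {μ : ℝ} (hμ0 : 0 ≤ μ) (hμ : μ ≤ 1)
    (hB : ∀ x ∈ G, ((bigSupport x).card : ℝ) ≤ μ * d) {z : Fin d → ℝ} (hz : ∀ i, 0 ≤ z i) :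
    ∑ x ∈ G, ∏ i ∈ bigSupport x, (1 + z i) ≤ G.card * ∏ i, (1 + μ * z i) := by
  have h : ∀ x : Fin d → ℤ, ∏ i ∈ bigSupport x, (1 + z i) =
      ∑ L : Finset (Fin d), if L ⊆ bigSupport x then ∏ i ∈ L, z i else 0 := by
    intro x
    rw [Finset.prod_one_add, ← Finset.sum_filter]
    refine Finset.sum_congr ?_ fun _ _ => rfl
    ext L; simp
  simp only [h]
  rw [Finset.sum_comm, Finset.prod_one_add, Finset.mul_sum, Finset.powerset_univ]
  refine Finset.sum_le_sum fun L _ => ?_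
  rw [← Finset.sum_filter, Finset.sum_const, nsmul_eq_mul, Finset.prod_mul_distrib,
    Finset.prod_const]
  have := mul_le_mul_of_nonneg_right (card_filter_subset_bigSupport_le hG hμ0 hμ hB L)
    (Finset.prod_nonneg fun i (_ : i ∈ L) => hz i)
  linarith

/-- Omitting the big support costs a factor `exp(a s_i)` at each of its points. With density at most
`1/4` the average cost is at most `∏ (1 + (exp(a s_i) - 1)/4)`, and `1 + (e^u - 1)/4 ≤ e^(u/2)` on
`[0, 1]`, so half of the exponent survives. -/
theorem sum_exp_neg_compl_bigSupport_le {d : ℕ} {G : Finset (Fin d → ℤ)}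
    (hG : ∀ x ∈ G, ∀ σ : Equiv.Perm (Fin d), x ∘ σ ∈ G)
    (hB : ∀ x ∈ G, ((bigSupport x).card : ℝ) ≤ 1 / 4 * d) {a : ℝ} (ha0 : 0 ≤ a) (ha1 : a ≤ 1)
    {s : Fin d → ℝ} (hs0 : ∀ i, 0 ≤ s i) (hs1 : ∀ i, s i ≤ 1) :
    ∑ x ∈ G, Real.exp (-(a * ∑ i ∈ Finset.univ.filter (fun i => bigPart (x i) = 0), s i)) ≤
      G.card * Real.exp (-(a / 2 * ∑ i, s i)) := by
  have hexp : ∀ x : Fin d → ℤ,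
      Real.exp (-(a * ∑ i ∈ Finset.univ.filter (fun i => bigPart (x i) = 0), s i)) =
        Real.exp (-(a * ∑ i, s i)) * ∏ i ∈ bigSupport x, (1 + (Real.exp (a * s i) - 1)) := by
    intro x
    simp only [add_sub_cancel]
    rw [← Real.exp_sum, ← Finset.mul_sum, ← Real.exp_add, bigSupport,
      ← Finset.sum_filter_add_sum_filter_not Finset.univ (fun i => bigPart (x i) = 0) s]
    congr 1; ring
  simp only [hexp]
  rw [← Finset.mul_sum]
  have hz : ∀ i, 0 ≤ Real.exp (a * s i) - 1 := by
    intro i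
    have := Real.one_le_exp (mul_nonneg ha0 (hs0 i))
    linarith
  have h := sum_prod_bigSupport_le hG (by norm_num) (by norm_num) hB hz
  have hfac : ∀ i, 1 + 1 / 4 * (Real.exp (a * s i) - 1) ≤ Real.exp (a / 2 * s i) := by
    intro i
    have hu0 : 0 ≤ a * s i := mul_nonneg ha0 (hs0 i)
    have hu1 : a * s i ≤ 1 := mul_le_one₀ ha1 (hs0 i) (hs1 i)
    have h1 := (abs_le.mp (Real.abs_exp_sub_one_sub_id_le (abs_le.2 ⟨by linarith, hu1⟩))).2
    have h2 := Real.add_one_le_exp (a / 2 * s i)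
    nlinarith
  have hprod : ∏ i, (1 + 1 / 4 * (Real.exp (a * s i) - 1)) ≤ Real.exp (a / 2 * ∑ i, s i) := by
    rw [Finset.mul_sum, Real.exp_sum]
    exact Finset.prod_le_prod (fun i _ => by linarith [hz i]) fun i _ => hfac i
  calc _ ≤ Real.exp (-(a * ∑ i, s i)) * (G.card * Real.exp (a / 2 * ∑ i, s i)) := by
        gcongr
        exact h.trans (by gcongr)
    _ = _ := by
        rw [mul_left_comm, ← Real.exp_add]
        congr 2; ring

/-! ### Rarity of points with few unit coordinates -/

theorem pow_mul_choose_le {m d : ℕ} (h : m ≤ d) (r : ℕ) :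
    (d : ℝ) ^ r * m.choose r ≤ (m : ℝ) ^ r * d.choose r := by
  induction r with
  | zero => simp
  | succ r ih =>
    rcases lt_or_ge m (r + 1) with hr | hr
    · rw [Nat.choose_eq_zero_of_lt hr]; simp; positivity
    have h1 := congrArg (Nat.cast : ℕ → ℝ) (Nat.choose_succ_right_eq m r)
    have h2 := congrArg (Nat.cast : ℕ → ℝ) (Nat.choose_succ_right_eq d r)
    rw [Nat.cast_mul, Nat.cast_mul, Nat.cast_sub (by omega)] at h1 h2
    push_cast at h1 h2
    have hr0 : (0 : ℝ) < r + 1 := by positivity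
    refine le_of_mul_le_mul_right ?_ hr0
    have hmr : (0 : ℝ) ≤ m - r := by
      have : ((r + 1 : ℕ) : ℝ) ≤ m := by exact_mod_cast hr
      push_cast at this; linarith
    have hmd : (m : ℝ) ≤ d := by exact_mod_cast h
    calc (d : ℝ) ^ (r + 1) * m.choose (r + 1) * (r + 1)
        = ((d : ℝ) ^ r * m.choose r) * (d * (m - r)) := by rw [mul_assoc, h1]; ring
      _ ≤ ((m : ℝ) ^ r * d.choose r) * (m * (d - r)) := by
          have h3 : (d : ℝ) * (m - r) ≤ m * (d - r) := by
            nlinarith [(Nat.cast_nonneg r : (0 : ℝ) ≤ r)]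
          gcongr
      _ = (m : ℝ) ^ (r + 1) * d.choose (r + 1) * (r + 1) := by
          rw [mul_assoc ((m : ℝ) ^ (r + 1)), h2]; ring

/-- The fibre over `y = 0`, with exactly `lam` unit coordinates, already has this size. -/
theorem two_pow_mul_choose_le_card_latticeSphere (d lam : ℕ) :
    2 ^ lam * (d.choose lam : ℝ) ≤ (latticeSphere d lam).card := by
  have h := card_sphereFiber (d := d) 0 lam
  simp [intNormSq] at h
  rw [← h]
  norm_cast
  refine Finset.card_le_card fun x hx => ?_
  rw [mem_latticeSphere_iff_intNormSq]
  simpa [sphereFiber] using (Finset.mem_filter.1 hx).2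

/-- The square of the part of an integer that is removed by `bigPart`. -/
def unitPartSq (j : ℤ) : ℕ := if j.natAbs = 1 then 1 else 0

theorem unitPartSq_add_sq (j : ℤ) : unitPartSq j + (bigPart j).natAbs ^ 2 = j.natAbs ^ 2 := by
  unfold unitPartSq bigPart
  rw [Int.abs_eq_natAbs]
  split_ifs with h1 h2 h2
  · omega
  · simp [h1]
  · simp
  · have : j = 0 := by omega
    simp [this]

theorem sum_Icc_weight_le {z : ℝ} (hz0 : 0 ≤ z) (hz : z ≤ 1 / 8) (N : ℕ) :
    ∑ j ∈ Finset.Icc (-(N : ℤ)) N, (1 / 16 : ℝ) ^ unitPartSq j * z ^ (j.natAbs ^ 2) ≤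
      1 + z / 4 := by
  rw [Finset.sum_Icc_of_even_eq_range (f := fun j : ℤ =>
    (1 / 16 : ℝ) ^ unitPartSq j * z ^ (j.natAbs ^ 2)) (by intro j; simp [unitPartSq])]
  have h4 : 32 * z ^ 4 ≤ z := by
    have : z ^ 3 ≤ (1 / 8) ^ 3 := by gcongr
    nlinarith
  -- The squares are at least `4, 5, 6, …`, so a geometric series dominates the tail; the subtracted
  -- term makes the induction close.
  have key : ∀ N : ℕ, ∑ m ∈ Finset.range (N + 2),
      (1 / 16 : ℝ) ^ unitPartSq (m : ℤ) * z ^ ((m : ℤ).natAbs ^ 2) ≤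
      1 + z / 16 + 2 * z ^ 4 - 2 * z ^ (N + 4) := by
    intro N
    induction N with
    | zero => simp [Finset.sum_range_succ, unitPartSq]; linarith
    | succ N ih =>
      rw [Finset.sum_range_succ]
      have h1 : unitPartSq ((N + 1 + 1 : ℕ) : ℤ) = 0 := by
        unfold unitPartSq; rw [if_neg]; omega
      have h2 : z ^ (((N + 1 + 1 : ℕ) : ℤ).natAbs ^ 2) ≤ z ^ (N + 4) := by
        apply pow_le_pow_of_le_one hz0 (by linarith)
        rw [Int.natAbs_natCast]; nlinarith
      have h3 : z ^ (N + 1 + 4) ≤ 1 / 8 * z ^ (N + 4) := by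
        rw [show N + 1 + 4 = (N + 4) + 1 by ring, pow_succ']; gcongr
      have h5 : 0 ≤ z ^ (N + 4) := by positivity
      have : N + 1 + 2 = N + 2 + 1 := by ring
      rw [h1]
      linarith
  rcases N with _ | N
  · simp [unitPartSq]; linarith
  · have := key N
    have h5 : 0 ≤ z ^ (N + 4) := by positivity
    simp only [two_nsmul]
    simp only [unitPartSq] at *
    norm_num at *
    linarith

/-- Most points of a sphere of small radius have many coordinates equal to `±1`. -/
theorem card_filter_bigPart_latticeSphere_le {d lam : ℕ} (hlam : 1 ≤ lam) (hd : 25 * lam ≤ d) :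
    (((latticeSphere d lam).filter fun x =>
        ¬ 4 * intNormSq (fun i => bigPart (x i)) ≤ 3 * lam).card : ℝ) ≤
      (latticeSphere d lam).card * Real.exp (-(lam / 200 : ℝ)) := by
  have hlam' : (0 : ℝ) < lam := by exact_mod_cast hlam
  have hd' : (25 : ℝ) * lam ≤ d := by exact_mod_cast hd
  have hd0 : (0 : ℝ) < d := by linarith
  set q : ℝ := lam / d with hq
  have hq0 : 0 < q := by positivity
  have hq1 : q ≤ 1 / 25 := by rw [hq, div_le_iff₀ hd0]; linarith
  -- A bad point has fewer than `lam/4` units, so the penalty `1/16` per unit costs at most `2^lam`.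
  -- The factor 2 in `2 * q` compensates exactly, leaving weight at least `q^lam`.
  set wt : ℤ → ℝ := fun j => (1 / 16 : ℝ) ^ unitPartSq j * (2 * q) ^ (j.natAbs ^ 2) with hwt
  have hwt0 : ∀ j, 0 ≤ wt j := fun j => by positivity
  have hprod : ∀ x : Fin d → ℤ, ∏ i, wt (x i) =
      (1 / 16 : ℝ) ^ (∑ i, unitPartSq (x i)) * (2 * q) ^ intNormSq x := by
    intro x
    simp only [hwt, Finset.prod_mul_distrib, Finset.prod_pow_eq_pow_sum, intNormSq]
  set bad := (latticeSphere d lam).filter fun x =>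
    ¬ 4 * intNormSq (fun i => bigPart (x i)) ≤ 3 * lam with hbad
  have hone : ∀ x ∈ bad, q ^ lam ≤ ∏ i, wt (x i) := by
    intro x hx
    obtain ⟨hxS, hxb⟩ := Finset.mem_filter.1 hx
    rw [mem_latticeSphere_iff_intNormSq] at hxS
    have hsum : ∑ i, unitPartSq (x i) + intNormSq (fun i => bigPart (x i)) = lam := by
      rw [← hxS, intNormSq, intNormSq, ← Finset.sum_add_distrib]
      exact Finset.sum_congr rfl fun i _ => unitPartSq_add_sq _
    rw [hprod, hxS, mul_pow, ← mul_assoc]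
    have h16 : (1 / 16 : ℝ) ^ (∑ i, unitPartSq (x i)) =
        (1 / 2 : ℝ) ^ (4 * ∑ i, unitPartSq (x i)) := by
      rw [pow_mul]; norm_num
    have hle : (1 / 2 : ℝ) ^ lam ≤ (1 / 2 : ℝ) ^ (4 * ∑ i, unitPartSq (x i)) :=
      pow_le_pow_of_le_one (by norm_num) (by norm_num) (by omega)
    rw [h16]
    have h2 : (1 / 2 : ℝ) ^ lam * 2 ^ lam = 1 := by rw [← mul_pow]; norm_num
    calc q ^ lam = ((1 / 2 : ℝ) ^ lam * 2 ^ lam) * q ^ lam := by rw [h2, one_mul]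
      _ ≤ _ := by gcongr
  have hup : (bad.card : ℝ) * q ^ lam ≤ Real.exp (lam / 2) := by
    calc (bad.card : ℝ) * q ^ lam = ∑ x ∈ bad, q ^ lam := by
          rw [Finset.sum_const, nsmul_eq_mul]
      _ ≤ ∑ x ∈ bad, ∏ i, wt (x i) := Finset.sum_le_sum hone
      _ ≤ ∑ x ∈ Fintype.piFinset fun _ : Fin d => Finset.Icc (-(lam : ℤ)) lam,
            ∏ i, wt (x i) := by
          refine Finset.sum_le_sum_of_subset_of_nonneg ?_
            fun x _ _ => Finset.prod_nonneg fun i _ => hwt0 _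
          exact (Finset.filter_subset _ _).trans (Finset.filter_subset _ _)
      _ = (∑ j ∈ Finset.Icc (-(lam : ℤ)) lam, wt j) ^ d := by
          rw [Finset.sum_pow']
      _ ≤ (Real.exp (q / 2)) ^ d := by
          refine pow_le_pow_left₀ (Finset.sum_nonneg fun j _ => hwt0 j) ?_ d
          have h1 := sum_Icc_weight_le (z := 2 * q) (by positivity) (by linarith) lam
          have h2 := Real.add_one_le_exp (q / 2)
          simp only [hwt]
          linarith
      _ = Real.exp (lam / 2) := by
          rw [← Real.exp_nat_mul, hq]
          congr 1; field_simp
  have hlow : (2 : ℝ) ^ lam ≤ (latticeSphere d lam).card * q ^ lam := by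
    have h1 := two_pow_mul_choose_le_card_latticeSphere d lam
    have h2 := pow_mul_choose_le (by omega : lam ≤ d) lam
    rw [Nat.choose_self, Nat.cast_one, mul_one] at h2
    have h3 : 1 ≤ (d.choose lam : ℝ) * q ^ lam := by
      rw [hq, div_pow, mul_div_assoc', le_div_iff₀ (by positivity)]
      linarith
    calc (2 : ℝ) ^ lam ≤ 2 ^ lam * ((d.choose lam : ℝ) * q ^ lam) :=
          le_mul_of_one_le_right (by positivity) h3
      _ = 2 ^ lam * (d.choose lam : ℝ) * q ^ lam := by ring
      _ ≤ _ := by gcongr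
  -- This is `log 2 - 1/2 ≥ 1/200`.
  have hexp : Real.exp (lam / 2) ≤ 2 ^ lam * Real.exp (-(lam / 200 : ℝ)) := by
    have h2 : (2 : ℝ) ^ lam = Real.exp (lam * Real.log 2) := by
      rw [Real.exp_nat_mul, Real.exp_log (by norm_num)]
    rw [h2, ← Real.exp_add, Real.exp_le_exp]
    nlinarith [Real.log_two_gt_d9]
  have hqp : 0 < q ^ lam := by positivity
  refine le_of_mul_le_mul_right ?_ hqp
  have := mul_le_mul_of_nonneg_right hlow (Real.exp_pos (-(lam / 200 : ℝ))).le
  linarith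

/-! ### Assembling the multiplier bound -/

theorem bigSupport_card_add {d : ℕ} (x : Fin d → ℤ) :
    (Finset.univ.filter fun i => bigPart (x i) = 0).card + (bigSupport x).card = d := by
  have := Finset.card_filter_add_card_filter_not (s := (Finset.univ : Finset (Fin d)))
    (fun i => bigPart (x i) = 0)
  simpa [bigSupport] using this

theorem four_mul_card_bigSupport_le {d : ℕ} (x : Fin d → ℤ) :
    4 * (bigSupport x).card ≤ intNormSq fun i => bigPart (x i) := by
  have h : ∀ i ∈ bigSupport x, 4 ≤ (bigPart (x i)).natAbs ^ 2 := by
    intro i hi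
    rw [mem_bigSupport] at hi
    have : 2 ≤ (bigPart (x i)).natAbs := by
      unfold bigPart at hi ⊢
      rw [Int.abs_eq_natAbs] at hi ⊢
      split_ifs at hi ⊢ with h
      · omega
      · exact absurd rfl hi
    nlinarith
  calc 4 * (bigSupport x).card = ∑ i ∈ bigSupport x, 4 := by simp [mul_comm]
    _ ≤ ∑ i ∈ bigSupport x, (bigPart (x i)).natAbs ^ 2 := Finset.sum_le_sum h
    _ ≤ _ := Finset.sum_le_sum_of_subset (Finset.subset_univ _)

theorem intNormSq_comp_perm {d : ℕ} (x : Fin d → ℤ) (σ : Equiv.Perm (Fin d)) :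
    intNormSq (x ∘ σ) = intNormSq x :=
  Equiv.sum_comp σ fun i => (x i).natAbs ^ 2

/-- The exponential sum over the points of a sphere with many coordinates equal to `±1`. -/
theorem IsKrawtchoukConstant.norm_sum_filter_latticeSphere_le {c : ℝ}
    (hc : IsKrawtchoukConstant c) {d lam : ℕ} (hlam : 1 ≤ lam) (hd : 25 * lam ≤ d)
    (ξ : Fin d → ℝ) {G : Finset (Fin d → ℤ)}
    (hG : G = (latticeSphere d lam).filter fun x =>
      4 * intNormSq (fun i => bigPart (x i)) ≤ 3 * lam) :
    ‖∑ x ∈ G, latticeChar ξ x‖ ≤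
      G.card * (Real.exp (-(c * lam / (16 * d) * ∑ i, Real.sin (Real.pi * ξ i) ^ 2)) +
        Real.exp (-(c * lam / (16 * d) * ∑ i, Real.cos (Real.pi * ξ i) ^ 2))) := by
  have hlam' : (0 : ℝ) < lam := by exact_mod_cast hlam
  have hd' : (25 : ℝ) * lam ≤ d := by exact_mod_cast hd
  have hd0 : (0 : ℝ) < d := by linarith
  have hc0 := hc.1
  have hc1 := hc.2.1
  set a : ℝ := c * lam / (8 * d) with ha
  have ha0 : 0 < a := by positivity
  have ha1 : a ≤ 1 / 200 := by
    rw [ha, div_le_iff₀ (by positivity)]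
    nlinarith
  have ha2 : c * lam / (16 * d) = a / 2 := by rw [ha]; field_simp; norm_num
  set s := fun i => Real.sin (Real.pi * ξ i) ^ 2 with hs
  set t := fun i => Real.cos (Real.pi * ξ i) ^ 2 with ht
  set I : (Fin d → ℤ) → Finset (Fin d) := fun x => Finset.univ.filter fun i => bigPart (x i) = 0
    with hI
  have hgood : ∀ x ∈ G, 16 * (bigSupport x).card ≤ 3 * lam := by
    intro x hx
    rw [hG, Finset.mem_filter] at hx
    have := four_mul_card_bigSupport_le x
    omega
  have hperm : ∀ x ∈ G, ∀ σ : Equiv.Perm (Fin d), x ∘ σ ∈ G := by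
    intro x hx σ
    rw [hG, Finset.mem_filter, mem_latticeSphere_iff_intNormSq] at hx ⊢
    rw [intNormSq_comp_perm]
    have h : intNormSq (fun i => bigPart ((x ∘ σ) i)) = intNormSq (fun i => bigPart (x i)) :=
      intNormSq_comp_perm (fun i => bigPart (x i)) σ
    rw [h]
    exact hx
  have hB : ∀ x ∈ G, ((bigSupport x).card : ℝ) ≤ 1 / 4 * d := by
    intro x hx
    have : ((16 * (bigSupport x).card : ℕ) : ℝ) ≤ (3 * lam : ℕ) := by exact_mod_cast hgood x hx
    push_cast at this
    linarith
  have hfib : ‖∑ x ∈ G, latticeChar ξ x‖ ≤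
      ∑ x ∈ G, (Real.exp (-(a * ∑ i ∈ I x, s i)) + Real.exp (-(a * ∑ i ∈ I x, t i))) := by
    have hmaps : ∀ x ∈ G, (fun i => bigPart (x i)) ∈ G.image fun x i => bigPart (x i) :=
      fun x hx => Finset.mem_image_of_mem _ hx
    rw [← Finset.sum_fiberwise_of_maps_to hmaps (latticeChar ξ),
      ← Finset.sum_fiberwise_of_maps_to hmaps (fun x =>
        Real.exp (-(a * ∑ i ∈ I x, s i)) + Real.exp (-(a * ∑ i ∈ I x, t i)))]
    refine (norm_sum_le _ _).trans (Finset.sum_le_sum fun y hy => ?_)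
    obtain ⟨x₀, hx₀, rfl⟩ := Finset.mem_image.1 hy
    set y : Fin d → ℤ := fun i => bigPart (x₀ i) with hy_def
    have hsupp := hgood x₀ hx₀
    have hx₀' := hx₀
    rw [hG, Finset.mem_filter] at hx₀'
    change _ ∧ 4 * intNormSq y ≤ 3 * lam at hx₀'
    obtain ⟨k, hk⟩ : ∃ k, lam = k + intNormSq y := ⟨lam - intNormSq y, by omega⟩
    have hfilter : G.filter (fun x => (fun i => bigPart (x i)) = y) =
        sphereFiber (k + intNormSq y) y := by
      rw [← hk, ← filter_latticeSphere_eq_sphereFiber fun i => bigPart_bigPart _, hG,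
        Finset.filter_filter]
      refine Finset.filter_congr fun x _ => ⟨fun h => h.2, fun h => ⟨?_, h⟩⟩
      rw [h]; exact hx₀'.2
    have hconst : ∀ x ∈ G.filter (fun x => (fun i => bigPart (x i)) = y), I x = I x₀ := by
      intro x hx
      have h := (Finset.mem_filter.1 hx).2
      simp only [hI]
      refine Finset.filter_congr fun i _ => ?_
      rw [show bigPart (x i) = bigPart (x₀ i) from congrFun h i]
    have hcardI := bigSupport_card_add x₀
    have hkI : 2 * k ≤ (I x₀).card := by
      simp only [hI]; omega
    have h := hc.norm_sum_sphereFiber_le ξ y (I := I x₀) rfl hkI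
    have hsum : ∑ x ∈ G.filter (fun x => (fun i => bigPart (x i)) = y),
        (Real.exp (-(a * ∑ i ∈ I x, s i)) + Real.exp (-(a * ∑ i ∈ I x, t i))) =
        ∑ x ∈ G.filter (fun x => (fun i => bigPart (x i)) = y),
          (Real.exp (-(a * ∑ i ∈ I x₀, s i)) + Real.exp (-(a * ∑ i ∈ I x₀, t i))) :=
      Finset.sum_congr rfl fun x hx => by rw [hconst x hx]
    rw [hsum, Finset.sum_const, nsmul_eq_mul, hfilter]
    refine h.trans ?_
    have hIpos : (0 : ℝ) < (I x₀).card := by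
      have : 0 < (I x₀).card := by simp only [hI]; omega
      exact_mod_cast this
    have hId : ((I x₀).card : ℝ) ≤ d := by
      have : (I x₀).card ≤ d := by simp only [hI]; omega
      exact_mod_cast this
    -- On these fibres `k ≥ lam/4` and `|I| ≤ d`.
    have hka : 2 * a ≤ c * k / (I x₀).card := by
      have hk4 : (lam : ℝ) ≤ 4 * k := by
        have : lam ≤ 4 * k := by omega
        exact_mod_cast this
      have e : 2 * a = c * (lam / 4) / d := by rw [ha]; field_simp; norm_num
      rw [e]
      gcongr
      linarith
    -- `1 - exp(-2a) ≥ 2a - 4a² ≥ a`, since `a` is small.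
    have hθ : a ≤ 1 - Real.exp (-(c * k / (I x₀).card)) := by
      have h1 : Real.exp (-(c * k / (I x₀).card)) ≤ Real.exp (-(2 * a)) :=
        Real.exp_le_exp.2 (by linarith)
      have h2 := (abs_le.mp (Real.abs_exp_sub_one_sub_id_le
        (x := -(2 * a)) (abs_le.2 ⟨by linarith, by linarith⟩))).2
      nlinarith
    have hs0 : 0 ≤ ∑ i ∈ I x₀, s i := Finset.sum_nonneg fun i _ => sq_nonneg _
    have ht0 : 0 ≤ ∑ i ∈ I x₀, t i := Finset.sum_nonneg fun i _ => sq_nonneg _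
    gcongr
  refine hfib.trans ?_
  rw [Finset.sum_add_distrib, ha2, mul_add]
  exact add_le_add
    (sum_exp_neg_compl_bigSupport_le hperm hB ha0.le (by linarith) (fun i => sq_nonneg _)
      fun i => Real.sin_sq_le_one _)
    (sum_exp_neg_compl_bigSupport_le hperm hB ha0.le (by linarith) (fun i => sq_nonneg _)
      fun i => Real.cos_sq_le_one _)

/-- The two sums add up to `d`, so one of them is at most `d/2` and its exponential alone dominates.
-/
theorem exp_neg_le_add_exp_sin_cos {d : ℕ} {b r : ℝ} (hb : 0 ≤ b) (hbr : b * d ≤ 2 * r)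
    (ξ : Fin d → ℝ) :
    Real.exp (-r) ≤ Real.exp (-(b * ∑ i, Real.sin (Real.pi * ξ i) ^ 2)) +
      Real.exp (-(b * ∑ i, Real.cos (Real.pi * ξ i) ^ 2)) := by
  have hsum : ∑ i, Real.sin (Real.pi * ξ i) ^ 2 + ∑ i, Real.cos (Real.pi * ξ i) ^ 2 = d := by
    rw [← Finset.sum_add_distrib]; simp
  set S := ∑ i, Real.sin (Real.pi * ξ i) ^ 2
  set T := ∑ i, Real.cos (Real.pi * ξ i) ^ 2
  rw [← hsum] at hbr
  rcases le_total S T with h | h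
  · have h1 : Real.exp (-r) ≤ Real.exp (-(b * S)) := by
      apply Real.exp_le_exp.2
      nlinarith
    linarith [Real.exp_pos (-(b * T))]
  · have h1 : Real.exp (-r) ≤ Real.exp (-(b * T)) := by
      apply Real.exp_le_exp.2
      nlinarith
    linarith [Real.exp_pos (-(b * S))]

theorem IsKrawtchoukConstant.norm_sphericalMultiplier_le {c : ℝ} (hc : IsKrawtchoukConstant c)
    {d lam : ℕ} (hlam : 1 ≤ lam) (hd : 25 * lam ≤ d) (ξ : Fin d → ℝ) :
    ‖sphericalMultiplier d lam ξ‖ ≤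
      2 * (Real.exp (-(c * (lam / d) / 100 * ∑ i, Real.sin (Real.pi * ξ i) ^ 2)) +
        Real.exp (-(c * (lam / d) / 100 * ∑ i, Real.cos (Real.pi * ξ i) ^ 2))) := by
  have hlam' : (0 : ℝ) < lam := by exact_mod_cast hlam
  have hd' : (25 : ℝ) * lam ≤ d := by exact_mod_cast hd
  have hd0 : (0 : ℝ) < d := by linarith
  have hc0 := hc.1
  have hc1 := hc.2.1
  set E := Real.exp (-(c * (lam / d) / 100 * ∑ i, Real.sin (Real.pi * ξ i) ^ 2)) +
        Real.exp (-(c * (lam / d) / 100 * ∑ i, Real.cos (Real.pi * ξ i) ^ 2)) with hE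
  have hE0 : 0 ≤ E := by positivity
  set S := latticeSphere d lam with hS
  set P : (Fin d → ℤ) → Prop := fun x => 4 * intNormSq (fun i => bigPart (x i)) ≤ 3 * lam with hP
  have hgood : ‖∑ x ∈ S.filter P, latticeChar ξ x‖ ≤ S.card * E := by
    refine (hc.norm_sum_filter_latticeSphere_le hlam hd ξ rfl).trans ?_
    have hrate : c * (lam / d) / 100 ≤ c * lam / (16 * d) := by
      have : 0 ≤ c * lam / d := by positivity
      have e1 : c * (lam / d) / 100 = c * lam / d / 100 := by ring
      have e2 : c * lam / (16 * d) = c * lam / d / 16 := by field_simp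
      rw [e1, e2]; linarith
    have hs0 : 0 ≤ ∑ i, Real.sin (Real.pi * ξ i) ^ 2 := Finset.sum_nonneg fun i _ => sq_nonneg _
    have ht0 : 0 ≤ ∑ i, Real.cos (Real.pi * ξ i) ^ 2 := Finset.sum_nonneg fun i _ => sq_nonneg _
    rw [hE]
    gcongr
    exact Finset.filter_subset _ _
  have hbad : ‖∑ x ∈ S.filter (fun x => ¬ P x), latticeChar ξ x‖ ≤ S.card * E := by
    calc _ ≤ ∑ x ∈ S.filter (fun x => ¬ P x), ‖latticeChar ξ x‖ := norm_sum_le _ _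
      _ = (S.filter (fun x => ¬ P x)).card := by simp [norm_latticeChar]
      _ ≤ S.card * Real.exp (-(lam / 200 : ℝ)) := card_filter_bigPart_latticeSphere_le hlam hd
      _ ≤ S.card * E := by
        gcongr
        refine exp_neg_le_add_exp_sin_cos (by positivity) ?_ ξ
        -- The rate `1/100` matches the decay `lam/200` of the bad points: `c * lam / 100 ≤ 2 * (lam
        -- / 200)` because `c < 1`.
        have : c * ((lam : ℝ) / d) / 100 * d = c * lam / 100 := by field_simp
        rw [this]
        nlinarith
  have hsum : ‖∑ x ∈ S, latticeChar ξ x‖ ≤ S.card * (2 * E) := by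
    rw [← Finset.sum_filter_add_sum_filter_not S P]
    refine (norm_add_le _ _).trans ?_
    linarith
  have hdef : sphericalMultiplier d lam ξ = (S.card : ℂ)⁻¹ * ∑ x ∈ S, latticeChar ξ x := rfl
  rw [hdef, norm_mul, norm_inv, Complex.norm_natCast]
  exact inv_mul_le_of_le_mul₀ (Nat.cast_nonneg _) (by positivity) hsum

theorem proposition7p3 :
    (∃ c : ℝ, IsKrawtchoukConstant c) ∧
    ∃ C : ℝ, 0 < C ∧
      ∀ c : ℝ, IsKrawtchoukConstant c →
        ∀ d lam : ℕ, 5 ≤ d → 1 ≤ lam → proportionality d lam ≤ 1 / 5 →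
          ∀ ξ : Fin d → ℝ,
            ‖sphericalMultiplier d lam ξ‖ ≤
              C * (Real.exp (-(c * proportionality d lam ^ 2 / 100 *
                      ∑ i, Real.sin (Real.pi * ξ i) ^ 2)) +
                    Real.exp (-(c * proportionality d lam ^ 2 / 100 *
                      ∑ i, Real.cos (Real.pi * ξ i) ^ 2))) := by
  -- `C = 2` counts the good and the bad points once each.
  refine ⟨⟨1 / 8, isKrawtchoukConstant_one_eighth⟩, 2, by norm_num, ?_⟩
  intro c hc d lam hd hlam hκ ξ
  have hsq : proportionality d lam ^ 2 = (lam : ℝ) / d := Real.sq_sqrt (by positivity)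
  have hle : (lam : ℝ) / d ≤ 1 / 25 := by
    rw [← hsq]
    have h0 : 0 ≤ proportionality d lam := Real.sqrt_nonneg _
    nlinarith
  have hd0 : (0 : ℝ) < d := by exact_mod_cast (by omega : 0 < d)
  have hd25 : 25 * lam ≤ d := by
    rw [div_le_iff₀ hd0] at hle
    have : (25 : ℝ) * lam ≤ d := by linarith
    exact_mod_cast this
  rw [hsq]
  exact hc.norm_sphericalMultiplier_le hlam hd25 ξ
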